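/- Let $T$ be the binary rooted tree and let $\mathcal G\le\operatorname{Aut}T$ be the first Grigorchuk group, generated by the automorphism $a$ exchanging the two subtrees below the root and by the automorphisms $b,c,d$ that fix the first level and are defined recursively through their sections on the first level by $b=(a,c)$, $c=(a,d)$, $d=(1,b)$. The group $\mathcal G$ is contracting: the sections of its elements lie in $\mathcal G$, and there is a finite set $\mathcal M\subseteq\mathcal G$ such that for every $g\in\mathcal G$ all sections of $g$ at vertices at and below some level belong to $\mathcal M$. Its nucleus, i.e. the smallest such set $\mathcal M$, is $\mathcal N=\{1,a,b,c,d\}$. The portrait of $g\in\mathcal G$ is the finite decorated tree consisting of a single vertex decorated by $g$ if $g\in\mathcal N$, and otherwise of a root, decorated by the permutation that $g$ induces on the first level, with the portraits of the two first-level sections of $g$ attached below it. Let $a_n$ be the number of elements of $\mathcal G$ whose portrait has depth (length of the longest ray from the root to a leaf) at most $n$. Theorem. The portrait growth sequence $\{a_n\}_{n\ge 0}$ of $\mathcal G$ is given by $$a_0=5,\qquad a_n=2x_n+4y_n+2z_n+2X_n+4Y_n+2Z_n\quad\text{for } n\ge 1,$$ where $x_n,y_n,z_n,X_n,Y_n,Z_n$,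 $n\ge1$, are the sequences determined by the recursive relations, for $n\ge 1$, \begin{align*} x_{n+1}&=x_n^2+2y_n^2+z_n^2,\\ y_{n+1}&=x_nY_n+Y_nz_n+X_ny_n+y_nZ_n,\\ z_{n+1}&=X_n^2+2Y_n^2+Z_n^2,\\ X_{n+1}&=2x_ny_n+2y_nz_n,\\ Y_{n+1}&=x_nX_n+2y_nY_n+z_nZ_n,\\ Z_{n+1}&=2X_nY_n+2Y_nZ_n, \end{align*} with the initial conditions $x_1=y_1=z_1=Y_1=1$, $X_1=2$, $Z_1=0$. -/

import Mathlib

namespace PortraitGrowth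

/-! ### The regular rooted tree and its automorphisms -/

section Tree

variable {X : Type*}

/-- The regular rooted tree over the alphabet `X`: its vertices are the finite words over `X`, the
root is the empty word, and two words are adjacent when one of them is the other one followed by a
single letter. -/
def treeGraph (X : Type*) : SimpleGraph (List X) where
  Adj u v := (∃ x, v = u ++ [x]) ∨ (∃ x, u = v ++ [x])
  symm := ⟨fun _ _ h => Or.symm h⟩
  loopless := ⟨by
    rintro u (⟨x, hx⟩ | ⟨x, hx⟩) <;>
    · have := congrArg List.length hx
      simp at this⟩

/-- The automorphism group of the rooted tree: the permutations of the vertices that preserve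
incidence and the root. (For a finite alphabet, preservation of the root is automatic.) -/
def TreeAut (X : Type*) : Subgroup (Equiv.Perm (List X)) where
  carrier := {g | g [] = [] ∧
    ∀ u v, (treeGraph X).Adj (g u) (g v) ↔ (treeGraph X).Adj u v}
  one_mem' := ⟨rfl, fun _ _ => Iff.rfl⟩
  mul_mem' := by
    rintro g h ⟨hg, hg'⟩ ⟨hh, hh'⟩
    refine ⟨by simp [hh, hg], fun u v => ?_⟩
    rw [Equiv.Perm.mul_apply, Equiv.Perm.mul_apply, hg', hh']
  inv_mem' := by
    rintro g ⟨hg, hg'⟩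
    refine ⟨by rw [Equiv.Perm.inv_eq_iff_eq, hg], fun u v => ?_⟩
    rw [← hg']
    simp

theorem treeAut_nil (g : TreeAut X) : g.1 [] = [] := g.2.1

/-- A tree automorphism maps children to children. -/
theorem treeAut_child (g : TreeAut X) (u : List X) (x : X) :
    ∃ y, g.1 (u ++ [x]) = g.1 u ++ [y] := by
  induction u using List.reverseRecOn generalizing x with
  | nil =>
    have h : (treeGraph X).Adj (g.1 []) (g.1 [x]) := (g.2.2 _ _).2 (Or.inl ⟨x, rfl⟩)
    rcases h with ⟨y, hy⟩ | ⟨y, hy⟩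
    · exact ⟨y, hy⟩
    · rw [treeAut_nil] at hy
      simp at hy
  | append_singleton w z ih =>
    have h : (treeGraph X).Adj (g.1 (w ++ [z])) (g.1 (w ++ [z] ++ [x])) :=
      (g.2.2 _ _).2 (Or.inl ⟨x, rfl⟩)
    rcases h with ⟨y, hy⟩ | ⟨y, hy⟩
    · exact ⟨y, hy⟩
    · obtain ⟨z', hz'⟩ := ih z
      have h1 : g.1 w = g.1 (w ++ [z] ++ [x]) := by
        rw [hz'] at hy
        exact (List.append_inj' hy rfl).1
      have h2 := congrArg List.length (g.1.injective h1)
      simp at h2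

theorem treeAut_length (g : TreeAut X) (u : List X) : (g.1 u).length = u.length := by
  induction u using List.reverseRecOn with
  | nil => rw [treeAut_nil]
  | append_singleton w z ih =>
    obtain ⟨y, hy⟩ := treeAut_child g w z
    simp [hy, ih]

theorem treeAut_prefix (g : TreeAut X) (u v : List X) : ∃ w, g.1 (u ++ v) = g.1 u ++ w := by
  induction v using List.reverseRecOn with
  | nil => exact ⟨[], by simp⟩
  | append_singleton w z ih =>
    obtain ⟨t, ht⟩ := ih
    obtain ⟨y, hy⟩ := treeAut_child g (u ++ w) z
    exact ⟨t ++ [y], by rw [← List.append_assoc, hy, ht, List.append_assoc]⟩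

theorem treeAut_append (g : TreeAut X) (u v : List X) :
    g.1 (u ++ v) = g.1 u ++ (g.1 (u ++ v)).drop u.length := by
  obtain ⟨w, hw⟩ := treeAut_prefix g u v
  rw [hw, ← treeAut_length g u, List.drop_left]

theorem treeGraph_adj_append (p u v : List X) :
    (treeGraph X).Adj (p ++ u) (p ++ v) ↔ (treeGraph X).Adj u v := by
  simp [treeGraph, List.append_assoc]

/-- The section of `g` at the vertex `u`: the automorphism `h` of the tree with
`g (u ++ v) = g u ++ h v` for all words `v`. -/
def treeSection (g : TreeAut X) (u : List X) : TreeAut X :=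
  ⟨{ toFun := fun v => (g.1 (u ++ v)).drop u.length
     invFun := fun v => (g⁻¹.1 (g.1 u ++ v)).drop u.length
     left_inv := fun v => by
      beta_reduce
      rw [← treeAut_append]
      simp
     right_inv := fun v => by
      beta_reduce
      have h := treeAut_append g⁻¹ (g.1 u) v
      have h1 : g⁻¹.1 (g.1 u) = u := by simp
      rw [h1, treeAut_length] at h
      rw [← h]
      have h2 : g.1 (g⁻¹.1 (g.1 u ++ v)) = g.1 u ++ v := by simp
      rw [h2, ← treeAut_length g u, List.drop_left] },
   by
    refine ⟨?_, fun v w => ?_⟩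
    · simp [← treeAut_length g u]
    · rw [← treeGraph_adj_append (g.1 u)]
      simp only [Equiv.coe_fn_mk]
      rw [← treeAut_append, ← treeAut_append, g.2.2, treeGraph_adj_append]⟩

theorem treeSection_spec (g : TreeAut X) (u v : List X) :
    g.1 (u ++ v) = g.1 u ++ (treeSection g u).1 v := treeAut_append g u v

theorem treeAut_singleton (g : TreeAut X) (x : X) : [(g.1 [x]).headD x] = g.1 [x] := by
  obtain ⟨y, hy⟩ := treeAut_child g [] x
  rw [treeAut_nil] at hy
  simp only [List.nil_append] at hy
  rw [hy]
  rfl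

/-- The permutation of the first level of the tree (identified with `X`) induced by `g`. -/
def rootPerm (g : TreeAut X) : Equiv.Perm X where
  toFun x := (g.1 [x]).headD x
  invFun x := (g⁻¹.1 [x]).headD x
  left_inv x := by
    have h : [((g⁻¹).1 [(g.1 [x]).headD x]).headD ((g.1 [x]).headD x)] = [x] := by
      rw [treeAut_singleton, treeAut_singleton]
      simp
    exact List.singleton_injective h
  right_inv x := by
    have h : [(g.1 [((g⁻¹).1 [x]).headD x]).headD (((g⁻¹).1 [x]).headD x)] = [x] := by
      rw [treeAut_singleton, treeAut_singleton]
      simp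
    exact List.singleton_injective h

theorem rootPerm_spec (g : TreeAut X) (x : X) : g.1 [x] = [rootPerm g x] :=
  (treeAut_singleton g x).symm

/-! ### Self-similar and contracting groups, the nucleus -/

/-- `G` is self-similar: all sections of its elements belong to `G`. -/
def IsSelfSimilar (G : Subgroup (TreeAut X)) : Prop :=
  ∀ g ∈ G, ∀ u, treeSection g u ∈ G

/-- `M` is a finite set of elements of `G` such that, for every `g ∈ G`, there is a level `n` such
that all sections of `g` at the vertices at and below level `n` belong to `M`. -/
def IsAttracting (G : Subgroup (TreeAut X)) (M : Set (TreeAut X)) : Prop :=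
  M.Finite ∧ M ⊆ (G : Set (TreeAut X)) ∧
    ∀ g ∈ G, ∃ n : ℕ, ∀ u : List X, n ≤ u.length → treeSection g u ∈ M

/-- `G` is contracting. -/
def IsContracting (G : Subgroup (TreeAut X)) : Prop :=
  IsSelfSimilar G ∧ ∃ M, IsAttracting G M

/-- The nucleus of a contracting group: the smallest attracting set
(see `isLeast_nucleus`). -/
def nucleus (G : Subgroup (TreeAut X)) : Set (TreeAut X) :=
  ⋂₀ {M | IsAttracting G M}

theorem IsAttracting.inter {G : Subgroup (TreeAut X)} {M M' : Set (TreeAut X)}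
    (h : IsAttracting G M) (h' : IsAttracting G M') : IsAttracting G (M ∩ M') := by
  refine ⟨h.1.inter_of_left _, Set.inter_subset_left.trans h.2.1, fun g hg => ?_⟩
  obtain ⟨n, hn⟩ := h.2.2 g hg
  obtain ⟨m, hm⟩ := h'.2.2 g hg
  exact ⟨max n m, fun u hu =>
    ⟨hn u (le_trans (le_max_left _ _) hu), hm u (le_trans (le_max_right _ _) hu)⟩⟩

theorem isLeast_nucleus {G : Subgroup (TreeAut X)} (hG : IsContracting G) :
    IsLeast {M | IsAttracting G M} (nucleus G) := by
  refine ⟨?_, fun M hM => Set.sInter_subset_of_mem hM⟩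
  classical
  have hex : ∃ k : ℕ, ∃ M, IsAttracting G M ∧ M.ncard = k := by
    obtain ⟨M, hM⟩ := hG.2
    exact ⟨_, M, hM, rfl⟩
  obtain ⟨M, hM, hk⟩ := Nat.find_spec hex
  have hMin : ∀ M', IsAttracting G M' → M ⊆ M' := by
    intro M' hM'
    have h1 : Nat.find hex ≤ (M ∩ M').ncard := Nat.find_min' hex ⟨_, hM.inter hM', rfl⟩
    have h2 : M ∩ M' = M := Set.eq_of_subset_of_ncard_le Set.inter_subset_left (by omega) hM.1
    exact Set.inter_eq_left.1 h2
  have h3 : nucleus G = M :=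
    Set.Subset.antisymm (Set.sInter_subset_of_mem hM) (Set.subset_sInter hMin)
  rw [h3]
  exact hM

end Tree

/-! ### Portraits and portrait growth -/

/-- Finite trees whose leaves are decorated by tree automorphisms and whose interior vertices are
decorated by permutations of `X` and have one child for every letter of `X`. -/
inductive Portrait (X : Type) : Type
  | leaf (g : TreeAut X) : Portrait X
  | node (α : Equiv.Perm X) (children : X → Portrait X) : Portrait X

/-- The length of the longest ray from the root to a leaf. -/
def Portrait.depth {X : Type} [Fintype X] : Portrait X → ℕ
  | .leaf _ => 0
  | .node _ children => (Finset.univ.sup fun x => (children x).depth) + 1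

/-- `IsPortrait N g P`: the tree `P` is the portrait of `g` with respect to the set `N`. If `g ∈ N`,
it consists of the root only, decorated by `g`. Otherwise its root is decorated by the permutation
of the first level induced by `g`, and the portraits of the sections of `g` at the vertices of the
first level are attached to these vertices. -/
inductive IsPortrait {X : Type} (N : Set (TreeAut X)) : TreeAut X → Portrait X → Prop
  | leaf {g : TreeAut X} (hg : g ∈ N) : IsPortrait N g (.leaf g)
  | node {g : TreeAut X} (hg : g ∉ N) (children : X → Portrait X)
      (hc : ∀ x, IsPortrait N (treeSection g [x]) (children x)) :
      IsPortrait N g (.node (rootPerm g) children)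

/-- The portrait growth sequence of `G` with respect to its nucleus: the number of elements of `G`
whose portrait has depth at most `n`. -/
noncomputable def portraitGrowth {X : Type} [Fintype X] (G : Subgroup (TreeAut X)) (n : ℕ) : ℕ :=
  {g : TreeAut X | g ∈ G ∧ ∃ P, IsPortrait (nucleus G) g P ∧ P.depth ≤ n}.ncard

/-! ### The first Grigorchuk group -/

/-- The action of `a` on the words over the two-letter alphabet: it exchanges the two subtrees below
the root. -/
def aFun : List Bool → List Bool
  | [] => []
  | x :: w => (!x) :: w

mutual
/-- The action of `b = (a, c)`. -/
def bFun : List Bool → List Bool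
  | [] => []
  | false :: w => false :: aFun w
  | true :: w => true :: cFun w
/-- The action of `c = (a, d)`. -/
def cFun : List Bool → List Bool
  | [] => []
  | false :: w => false :: aFun w
  | true :: w => true :: dFun w
/-- The action of `d = (1, b)`. -/
def dFun : List Bool → List Bool
  | [] => []
  | false :: w => false :: w
  | true :: w => true :: bFun w
end

theorem aFun_invol : Function.Involutive aFun := by
  intro w
  cases w <;> simp [aFun]

theorem bcdFun_invol (w : List Bool) :
    bFun (bFun w) = w ∧ cFun (cFun w) = w ∧ dFun (dFun w) = w := by
  induction w with
  | nil => simp [bFun, cFun, dFun]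
  | cons x w ih => cases x <;> simp [bFun, cFun, dFun, aFun_invol w, ih]

theorem aFun_child (u : List Bool) (x : Bool) : ∃ y, aFun (u ++ [x]) = aFun u ++ [y] := by
  cases u <;> simp [aFun]

theorem bcdFun_child (u : List Bool) (x : Bool) :
    (∃ y, bFun (u ++ [x]) = bFun u ++ [y]) ∧ (∃ y, cFun (u ++ [x]) = cFun u ++ [y]) ∧
      (∃ y, dFun (u ++ [x]) = dFun u ++ [y]) := by
  induction u with
  | nil => cases x <;> simp [bFun, cFun, dFun, aFun]
  | cons z u ih =>
    obtain ⟨y, hy⟩ := aFun_child u x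
    obtain ⟨⟨y1, h1⟩, ⟨y2, h2⟩, ⟨y3, h3⟩⟩ := ih
    cases z <;> simp [bFun, cFun, dFun, hy, h1, h2, h3]

/-- An involutive map of words that maps children to children is a tree automorphism. -/
def treeAutOfInvol {X : Type*} (f : List X → List X) (hf : Function.Involutive f)
    (hroot : f [] = []) (hchild : ∀ u x, ∃ y, f (u ++ [x]) = f u ++ [y]) : TreeAut X :=
  ⟨hf.toPerm f, by
    have key : ∀ u v, (treeGraph X).Adj u v → (treeGraph X).Adj (f u) (f v) := by
      rintro u v (⟨x, rfl⟩ | ⟨x, rfl⟩)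
      · exact Or.inl (hchild u x)
      · exact Or.inr (hchild v x)
    refine ⟨hroot, fun u v => ⟨fun h => ?_, key u v⟩⟩
    have h' := key _ _ h
    simpa [hf u, hf v] using h'⟩

/-- The rooted automorphism `a` exchanging the two subtrees on level 1. -/
def gA : TreeAut Bool := treeAutOfInvol aFun aFun_invol rfl aFun_child

/-- The automorphism `b = (a, c)`. -/
def gB : TreeAut Bool :=
  treeAutOfInvol bFun (fun w => (bcdFun_invol w).1) (by simp [bFun])
    (fun u x => (bcdFun_child u x).1)

/-- The automorphism `c = (a, d)`. -/
def gC : TreeAut Bool :=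
  treeAutOfInvol cFun (fun w => (bcdFun_invol w).2.1) (by simp [cFun])
    (fun u x => (bcdFun_child u x).2.1)

/-- The automorphism `d = (1, b)`. -/
def gD : TreeAut Bool :=
  treeAutOfInvol dFun (fun w => (bcdFun_invol w).2.2) (by simp [dFun])
    (fun u x => (bcdFun_child u x).2.2)

/-- The first Grigorchuk group. -/
def grigorchukGroup : Subgroup (TreeAut Bool) :=
  Subgroup.closure {gA, gB, gC, gD}

/-! The defining relations of the generators. -/

theorem treeSection_eq_of {X : Type*} {g h : TreeAut X} {u : List X}
    (H : ∀ v, g.1 (u ++ v) = g.1 u ++ h.1 v) : treeSection g u = h := by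
  refine Subtype.ext (Equiv.ext fun v => ?_)
  have := H v
  rw [treeSection_spec] at this
  exact List.append_cancel_left this

theorem gA_rec : (∀ x, rootPerm gA x = !x) ∧ ∀ x, treeSection gA [x] = 1 :=
  ⟨fun _ => rfl, fun _ => treeSection_eq_of fun _ => rfl⟩

theorem gB_rec : rootPerm gB = 1 ∧ treeSection gB [false] = gA ∧ treeSection gB [true] = gC := by
  refine ⟨Equiv.ext fun x => ?_, treeSection_eq_of fun v => ?_, treeSection_eq_of fun v => ?_⟩
  · cases x <;> rfl
  · rfl
  · rfl

theorem gC_rec : rootPerm gC = 1 ∧ treeSection gC [false] = gA ∧ treeSection gC [true] = gD := by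
  refine ⟨Equiv.ext fun x => ?_, treeSection_eq_of fun v => ?_, treeSection_eq_of fun v => ?_⟩
  · cases x <;> rfl
  · rfl
  · rfl

theorem gD_rec : rootPerm gD = 1 ∧ treeSection gD [false] = 1 ∧ treeSection gD [true] = gB := by
  refine ⟨Equiv.ext fun x => ?_, treeSection_eq_of fun v => ?_, treeSection_eq_of fun v => ?_⟩
  · cases x <;> rfl
  · rfl
  · rfl

end PortraitGrowth

namespace PortraitGrowth

/-! ### Sections and level parities -/

section Sections

variable {X : Type*}

-- An automorphism of the binary tree is determined by its root permutation and its two first-level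
-- sections. Since the nucleus is closed under sections, an element `g` of the group has portrait
-- depth at most `n + 1` exactly when both sections have depth at most `n`. Counting thus reduces to
-- deciding which pairs `(g₀, g₁)` occur as sections.
--
-- Modulo the normal closure of `b` the group is dihedral of order 8, generated by the images of `a`
-- and `d`. A pair from the group occurs iff the dihedral class of `g₁` is obtained from that of
-- `g₀` by the automorphism exchanging `a` and `d`, and then both root permutations occur
-- (`dihedralMap_treeSection`, `exists_treeSection_eq`).
--
-- Write `p k` for `levelParity k`. The dihedral class of `g` consists of `p 0` of `g` and `p 2` of
-- its sections, while `p 2` of `g` is the sum of `p 1` over the sections. On the group `p 1 = p 2 +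
-- p 3`, and `p 3` depends only on the dihedral class. Hence `p 2` together with the dihedral class
-- gives 16 classes whose counts satisfy a closed recursion (`classCount_succ`). From depth 1 on,
-- the counts do not depend on the root permutation and are symmetric in the two section parities,
-- which leaves six sequences, occurring with multiplicities 2, 4, 2, 2, 4, 2.

theorem treeSection_mul (g h : TreeAut X) (u : List X) :
    treeSection (g * h) u = treeSection g (h.1 u) * treeSection h u :=
  treeSection_eq_of fun v => by
    change g.1 (h.1 (u ++ v)) = g.1 (h.1 u) ++ (treeSection g (h.1 u)).1 ((treeSection h u).1 v)
    rw [treeSection_spec h, treeSection_spec g]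

theorem treeSection_append (g : TreeAut X) (u v : List X) :
    treeSection g (u ++ v) = treeSection (treeSection g u) v :=
  treeSection_eq_of fun w => by
    rw [List.append_assoc, treeSection_spec, treeSection_spec g u v, treeSection_spec,
      List.append_assoc]

@[simp] theorem treeSection_one (u : List X) : treeSection (1 : TreeAut X) u = 1 :=
  treeSection_eq_of fun _ => rfl

@[simp] theorem treeSection_nil (g : TreeAut X) : treeSection g [] = g :=
  treeSection_eq_of fun v => by rw [treeAut_nil]; rfl

theorem treeSection_mul_singleton (g h : TreeAut X) (x : X) :
    treeSection (g * h) [x] = treeSection g [rootPerm h x] * treeSection h [x] := by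
  rw [treeSection_mul, rootPerm_spec]

theorem rootPerm_mul (g h : TreeAut X) (x : X) :
    rootPerm (g * h) x = rootPerm g (rootPerm h x) := by
  have h1 : (g * h).1 [x] = g.1 (h.1 [x]) := rfl
  rw [rootPerm_spec, rootPerm_spec, rootPerm_spec] at h1
  exact List.singleton_injective h1

end Sections

/-- The parity of the number of vertices of level `k` at which `g` acts nontrivially. -/
def levelParity : ℕ → TreeAut Bool → Bool
  | 0, g => rootPerm g false
  | k + 1, g => xor (levelParity k (treeSection g [false])) (levelParity k (treeSection g [true]))

theorem perm_bool_apply (α : Equiv.Perm Bool) (x : Bool) : α x = xor x (α false) := by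
  revert α x
  decide

theorem rootPerm_eq (g : TreeAut Bool) (x : Bool) : rootPerm g x = xor x (levelParity 0 g) :=
  perm_bool_apply _ _

theorem treeSection_mul_bool (g h : TreeAut Bool) (x : Bool) :
    treeSection (g * h) [x] = treeSection g [xor x (levelParity 0 h)] * treeSection h [x] := by
  rw [treeSection_mul_singleton, rootPerm_eq]

theorem levelParity_mul (k : ℕ) (g h : TreeAut Bool) :
    levelParity k (g * h) = xor (levelParity k g) (levelParity k h) := by
  induction k generalizing g h with
  | zero =>
    change rootPerm (g * h) false = _
    rw [rootPerm_mul, rootPerm_eq g]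
    exact Bool.xor_comm _ _
  | succ k ih =>
    rw [levelParity, levelParity, levelParity, treeSection_mul_bool, treeSection_mul_bool, ih, ih]
    cases levelParity 0 h <;>
      simp only [Bool.xor_false, Bool.xor_true, Bool.not_false, Bool.not_true, Bool.xor_assoc,
        Bool.xor_left_comm, Bool.xor_comm]

@[simp] theorem levelParity_one (k : ℕ) : levelParity k 1 = false := by
  induction k with
  | zero => rfl
  | succ k ih => simp [levelParity, ih]

theorem treeAut_bool_ext {g h : TreeAut Bool} (h0 : levelParity 0 g = levelParity 0 h)
    (hs : ∀ x, treeSection g [x] = treeSection h [x]) : g = h := by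
  refine Subtype.ext (Equiv.ext fun w => ?_)
  cases w with
  | nil => rw [treeAut_nil, treeAut_nil]
  | cons x w =>
    have h1 := treeSection_spec g [x] w
    have h2 := treeSection_spec h [x] w
    rw [rootPerm_spec, rootPerm_eq] at h1 h2
    rw [hs, h0, ← h2] at h1
    exact h1

/-! ### The generators -/

@[simp] theorem treeSection_gA (x : Bool) : treeSection gA [x] = 1 := gA_rec.2 x
@[simp] theorem treeSection_gB_false : treeSection gB [false] = gA := gB_rec.2.1
@[simp] theorem treeSection_gB_true : treeSection gB [true] = gC := gB_rec.2.2
@[simp] theorem treeSection_gC_false : treeSection gC [false] = gA := gC_rec.2.1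
@[simp] theorem treeSection_gC_true : treeSection gC [true] = gD := gC_rec.2.2
@[simp] theorem treeSection_gD_false : treeSection gD [false] = 1 := gD_rec.2.1
@[simp] theorem treeSection_gD_true : treeSection gD [true] = gB := gD_rec.2.2

@[simp] theorem levelParity_zero_gA : levelParity 0 gA = true := rfl
@[simp] theorem levelParity_zero_gB : levelParity 0 gB = false := rfl
@[simp] theorem levelParity_zero_gC : levelParity 0 gC = false := rfl
@[simp] theorem levelParity_zero_gD : levelParity 0 gD = false := rfl
@[simp] theorem levelParity_succ_gA (k : ℕ) : levelParity (k + 1) gA = false := by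
  simp [levelParity]
@[simp] theorem levelParity_succ_gB (k : ℕ) :
    levelParity (k + 1) gB = xor (levelParity k gA) (levelParity k gC) := by
  simp [levelParity]
@[simp] theorem levelParity_succ_gC (k : ℕ) :
    levelParity (k + 1) gC = xor (levelParity k gA) (levelParity k gD) := by
  simp [levelParity]
@[simp] theorem levelParity_succ_gD (k : ℕ) : levelParity (k + 1) gD = levelParity k gB := by
  simp [levelParity]

theorem gA_mul_self : gA * gA = 1 := Subtype.ext (Equiv.ext aFun_invol)
theorem gB_mul_self : gB * gB = 1 := Subtype.ext (Equiv.ext fun w => (bcdFun_invol w).1)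
theorem gC_mul_self : gC * gC = 1 := Subtype.ext (Equiv.ext fun w => (bcdFun_invol w).2.1)
theorem gD_mul_self : gD * gD = 1 := Subtype.ext (Equiv.ext fun w => (bcdFun_invol w).2.2)

theorem bcdFun_comp (w : List Bool) :
    (bFun (cFun w) = dFun w ∧ cFun (dFun w) = bFun w ∧ dFun (bFun w) = cFun w) ∧
      cFun (bFun w) = dFun w ∧ dFun (cFun w) = bFun w ∧ bFun (dFun w) = cFun w := by
  induction w with
  | nil => simp [bFun, cFun, dFun]
  | cons x w ih => cases x <;> simp [bFun, cFun, dFun, aFun_invol w, ih]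

theorem gB_mul_gC : gB * gC = gD := Subtype.ext (Equiv.ext fun w => (bcdFun_comp w).1.1)
theorem gC_mul_gD : gC * gD = gB := Subtype.ext (Equiv.ext fun w => (bcdFun_comp w).1.2.1)
theorem gD_mul_gB : gD * gB = gC := Subtype.ext (Equiv.ext fun w => (bcdFun_comp w).1.2.2)
theorem gC_mul_gB : gC * gB = gD := Subtype.ext (Equiv.ext fun w => (bcdFun_comp w).2.1)
theorem gD_mul_gC : gD * gC = gB := Subtype.ext (Equiv.ext fun w => (bcdFun_comp w).2.2.1)
theorem gB_mul_gD : gB * gD = gC := Subtype.ext (Equiv.ext fun w => (bcdFun_comp w).2.2.2)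

/-- On the first level the two factors are `(1, b)` and `(b, 1)`. This relation makes `⟨a, d⟩` a
quotient of the dihedral group of order 8. -/
theorem commute_gD_conj : gD * (gA * gD * gA) = gA * gD * gA * gD :=
  treeAut_bool_ext (by simp [levelParity_mul]) fun x => by
    cases x <;> simp [treeSection_mul_bool, levelParity_mul]

theorem gA_mem : gA ∈ grigorchukGroup := Subgroup.subset_closure (by simp)
theorem gB_mem : gB ∈ grigorchukGroup := Subgroup.subset_closure (by simp)
theorem gC_mem : gC ∈ grigorchukGroup := Subgroup.subset_closure (by simp)
theorem gD_mem : gD ∈ grigorchukGroup := Subgroup.subset_closure (by simp)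

-- The generators are involutions, so inverses need no separate case.
@[elab_as_elim]
theorem grigorchuk_induction {P : (g : TreeAut Bool) → g ∈ grigorchukGroup → Prop}
    (one : P 1 (one_mem _))
    (mul : ∀ s (hs : s ∈ ({gA, gB, gC, gD} : Set (TreeAut Bool))), ∀ g (hg : g ∈ grigorchukGroup),
      P g hg → P (s * g) (mul_mem (Subgroup.subset_closure hs) hg))
    {g : TreeAut Bool} (hg : g ∈ grigorchukGroup) : P g hg := by
  induction hg using Subgroup.closure_induction_left with
  | one => exact one
  | mul_left s hs y hy ih => exact mul s hs y hy ih
  | inv_mul_cancel s hs y hy ih =>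
    have hinv : s⁻¹ = s := by
      rcases hs with rfl | rfl | rfl | rfl
      exacts [inv_eq_of_mul_eq_one_left gA_mul_self, inv_eq_of_mul_eq_one_left gB_mul_self,
        inv_eq_of_mul_eq_one_left gC_mul_self, inv_eq_of_mul_eq_one_left gD_mul_self]
    simp only [hinv]
    exact mul s hs y hy ih

/-! ### The dihedral quotient -/

/-- The multiplication of the dihedral group of order 8, seen as the wreath product of two groups
of order 2. -/
def dihedralMul (u v : Bool × Bool × Bool) : Bool × Bool × Bool :=
  (xor (bif v.2.2 then u.2.1 else u.1) v.1, xor (bif v.2.2 then u.1 else u.2.1) v.2.1,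
    xor u.2.2 v.2.2)

/-- The automorphism of the dihedral group that exchanges the images of `a` and `d`. -/
def dihedralSwap (u : Bool × Bool × Bool) : Bool × Bool × Bool :=
  dihedralMul (dihedralMul (false, u.2.2, false) (u.1, u.1, u.1)) (false, false, u.2.1)

theorem dihedralSwap_mul (u v : Bool × Bool × Bool) :
    dihedralSwap (dihedralMul u v) = dihedralMul (dihedralSwap u) (dihedralSwap v) := by
  revert u v
  decide

theorem dihedralSwap_swap (u : Bool × Bool × Bool) : dihedralSwap (dihedralSwap u) = u := by
  revert u
  decide

/-- The quotient map onto the dihedral group of order 8; its kernel in the Grigorchuk group is the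
normal closure of `b`. -/
def dihedralMap (g : TreeAut Bool) : Bool × Bool × Bool :=
  (levelParity 2 (treeSection g [false]), levelParity 2 (treeSection g [true]), levelParity 0 g)

theorem dihedralMap_mul (g h : TreeAut Bool) :
    dihedralMap (g * h) = dihedralMul (dihedralMap g) (dihedralMap h) := by
  simp only [dihedralMap, dihedralMul, treeSection_mul_bool, levelParity_mul]
  cases levelParity 0 h <;> simp

@[simp] theorem dihedralMap_one : dihedralMap 1 = (false, false, false) := by
  simp [dihedralMap]
@[simp] theorem dihedralMap_gA : dihedralMap gA = (false, false, true) := by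
  simp [dihedralMap]
@[simp] theorem dihedralMap_gB : dihedralMap gB = (false, false, false) := by
  simp [dihedralMap]
@[simp] theorem dihedralMap_gC : dihedralMap gC = (false, true, false) := by
  simp [dihedralMap]
@[simp] theorem dihedralMap_gD : dihedralMap gD = (false, true, false) := by
  simp [dihedralMap]

theorem dihedralMap_generator {s : TreeAut Bool}
    (hs : s ∈ ({gA, gB, gC, gD} : Set (TreeAut Bool))) :
    dihedralMap (treeSection s [true]) = dihedralSwap (dihedralMap (treeSection s [false])) := by
  rcases hs with rfl | rfl | rfl | rfl <;> simp <;> decide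

theorem treeSection_generator_mem {s : TreeAut Bool}
    (hs : s ∈ ({gA, gB, gC, gD} : Set (TreeAut Bool))) (x : Bool) :
    treeSection s [x] ∈ ({1, gA, gB, gC, gD} : Set (TreeAut Bool)) := by
  rcases hs with rfl | rfl | rfl | rfl <;> cases x <;> simp

theorem nucleusSet_subset {g : TreeAut Bool} (hg : g ∈ ({1, gA, gB, gC, gD} : Set (TreeAut Bool))) :
    g ∈ grigorchukGroup := by
  rcases hg with rfl | rfl | rfl | rfl | rfl
  exacts [one_mem _, gA_mem, gB_mem, gC_mem, gD_mem]

theorem treeSection_singleton_mem {g : TreeAut Bool} (hg : g ∈ grigorchukGroup) (x : Bool) :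
    treeSection g [x] ∈ grigorchukGroup := by
  induction hg using grigorchuk_induction with
  | one => simp [one_mem]
  | mul s hs g hg ih =>
    rw [treeSection_mul_bool]
    exact mul_mem (nucleusSet_subset (treeSection_generator_mem hs _)) ih

theorem isSelfSimilar_grigorchukGroup : IsSelfSimilar grigorchukGroup := by
  intro g hg u
  induction u generalizing g with
  | nil => simpa using hg
  | cons x u ih =>
    rw [← List.singleton_append, treeSection_append]
    exact ih _ (treeSection_singleton_mem hg x)

/-- Necessary condition on pairs of sections. The swap is an involutive automorphism, so the
condition survives products even when the right factor exchanges the two subtrees. -/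
theorem dihedralMap_treeSection {g : TreeAut Bool} (hg : g ∈ grigorchukGroup) :
    dihedralMap (treeSection g [true]) = dihedralSwap (dihedralMap (treeSection g [false])) := by
  induction hg using grigorchuk_induction with
  | one => simp; decide
  | mul s hs g hg ih =>
    have h1 := dihedralMap_generator hs
    rw [treeSection_mul_bool, treeSection_mul_bool, dihedralMap_mul, dihedralMap_mul,
      dihedralSwap_mul, ih]
    cases levelParity 0 g
    · simp [h1]
    · simp [h1, dihedralSwap_swap]

/-- Both sides are homomorphisms, so it suffices to compare them on the generators. -/
theorem levelParity_relation {g : TreeAut Bool} (hg : g ∈ grigorchukGroup) :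
    levelParity 1 g = xor (levelParity 2 g) (levelParity 3 g) := by
  induction hg using grigorchuk_induction with
  | one => simp
  | mul s hs g hg ih =>
    have h1 : levelParity 1 s = xor (levelParity 2 s) (levelParity 3 s) := by
      rcases hs with rfl | rfl | rfl | rfl <;> simp
    simp only [levelParity_mul, ih, h1, Bool.xor_assoc, Bool.xor_left_comm]

/-! ### The sections on the first level -/

/-- The elements `k` such that `(1, k)` belongs to the Grigorchuk group. -/
def rightRigid : Subgroup (TreeAut Bool) where
  carrier := {k | ∃ h ∈ grigorchukGroup, levelParity 0 h = false ∧
    treeSection h [false] = 1 ∧ treeSection h [true] = k}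
  one_mem' := ⟨1, one_mem _, by simp⟩
  mul_mem' := by
    rintro _ _ ⟨h, hh, h0, h1, rfl⟩ ⟨h', hh', h0', h1', rfl⟩
    exact ⟨h * h', mul_mem hh hh', by simp [levelParity_mul, treeSection_mul_bool, *]⟩
  inv_mem' := by
    rintro _ ⟨h, hh, h0, h1, rfl⟩
    have hp : levelParity 0 h⁻¹ = false := by
      have := levelParity_mul 0 h h⁻¹
      simpa [h0] using this
    have hsec : ∀ x, treeSection h⁻¹ [x] = (treeSection h [x])⁻¹ := fun x => by
      have := treeSection_mul_bool h h⁻¹ x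
      simp only [mul_inv_cancel, treeSection_one, hp, Bool.xor_false] at this
      exact eq_inv_of_mul_eq_one_right this.symm
    exact ⟨h⁻¹, inv_mem hh, hp, by rw [hsec, h1, inv_one], hsec _⟩

theorem gB_mem_rightRigid : gB ∈ rightRigid := ⟨gD, gD_mem, by simp⟩

/-- Each generator is the right section of some `r` fixing the first level whose left section
squares to 1: `aba = (c, a)`, `d = (1, b)`, `b = (a, c)`, `c = (a, d)`. Conjugating `(1, k)` by such
an `r` gives `(1, s * k * s)`. -/
theorem conj_mem_rightRigid {s k : TreeAut Bool}
    (hs : s ∈ ({gA, gB, gC, gD} : Set (TreeAut Bool))) (hk : k ∈ rightRigid) :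
    s * k * s ∈ rightRigid := by
  obtain ⟨h, hh, h0, h1, rfl⟩ := hk
  have key : ∀ r ∈ grigorchukGroup, levelParity 0 r = false →
      treeSection r [false] * treeSection r [false] = 1 →
      treeSection r [true] * treeSection h [true] * treeSection r [true] ∈ rightRigid :=
    fun r hr hr0 hr1 => ⟨r * h * r, mul_mem (mul_mem hr hh) hr, by
      simp [levelParity_mul, treeSection_mul_bool, hr0, h0, h1, hr1]⟩
  rcases hs with rfl | rfl | rfl | rfl
  · have := key (gA * gB * gA) (mul_mem (mul_mem gA_mem gB_mem) gA_mem)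
      (by simp [levelParity_mul])
    simp only [treeSection_mul_bool] at this
    simpa [gC_mul_self] using this
  · simpa using key gD gD_mem (by simp) (by simp)
  · simpa using key gB gB_mem (by simp) (by simp [gA_mul_self])
  · simpa using key gC gC_mem (by simp) (by simp [gA_mul_self])

/-- The representatives of the elements of the dihedral quotient in `⟨a, d⟩`. -/
def dihedralRep (u : Bool × Bool × Bool) : TreeAut Bool :=
  (bif u.2.2 then gA else 1) * (bif u.1 then gA * gD * gA else 1) * (bif u.2.1 then gD else 1)

theorem gA_mul_dihedralRep (u : Bool × Bool × Bool) :
    gA * dihedralRep u = dihedralRep (dihedralMul (false, false, true) u) := by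
  obtain ⟨s, t, e⟩ := u
  cases e <;> simp [dihedralRep, dihedralMul, ← mul_assoc, gA_mul_self]

theorem gD_mul_dihedralRep (u : Bool × Bool × Bool) :
    gD * dihedralRep u = dihedralRep (dihedralMul (false, true, false) u) := by
  have hA : ∀ g, gA * (gA * g) = g := fun g => by rw [← mul_assoc, gA_mul_self, one_mul]
  have hD : ∀ g, gD * (gD * g) = g := fun g => by rw [← mul_assoc, gD_mul_self, one_mul]
  have hc := commute_gD_conj
  have hc' : gD * (gA * (gD * (gA * gD))) = gA * (gD * gA) := by
    have := congrArg (· * gD) hc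
    simpa [mul_assoc, gD_mul_self] using this
  simp only [mul_assoc] at hc
  obtain ⟨s, t, e⟩ := u
  cases e <;> cases s <;> cases t <;>
    simp [dihedralRep, dihedralMul, mul_assoc, gD_mul_self, hA, hD, hc, hc']

/-- Shows that elements with the same dihedral class differ by a factor in `rightRigid`. -/
theorem mul_dihedralRep_inv_mem {g : TreeAut Bool} (hg : g ∈ grigorchukGroup) :
    g * (dihedralRep (dihedralMap g))⁻¹ ∈ rightRigid := by
  induction hg using grigorchuk_induction with
  | one => simp [dihedralRep, one_mem]
  | mul s hs g hg ih =>
    have step : ∀ s ∈ ({gA, gB, gC, gD} : Set (TreeAut Bool)), s * s = 1 →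
        s * dihedralRep (dihedralMap g) = dihedralRep (dihedralMap (s * g)) →
        s * g * (dihedralRep (dihedralMap (s * g)))⁻¹ ∈ rightRigid := by
      intro s hs h2 h
      have := conj_mem_rightRigid hs ih
      -- The representative of `s * g` is `s` times that of `g`, so the new quotient is the old one
      -- conjugated by `s`.
      rw [← h, mul_inv_rev, inv_eq_of_mul_eq_one_left h2]
      simpa only [mul_assoc] using this
    have hD : gD * g * (dihedralRep (dihedralMap (gD * g)))⁻¹ ∈ rightRigid :=
      step gD (by simp) gD_mul_self (by rw [gD_mul_dihedralRep, dihedralMap_mul, dihedralMap_gD])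
    rcases hs with rfl | rfl | rfl | rfl
    · exact step gA (by simp) gA_mul_self
        (by rw [gA_mul_dihedralRep, dihedralMap_mul, dihedralMap_gA])
    · have h1 : dihedralMap (gB * g) = dihedralMap g := by
        rw [dihedralMap_mul, dihedralMap_gB]
        simp [dihedralMul]
      rw [h1, mul_assoc]
      exact mul_mem gB_mem_rightRigid ih
    · have h1 : dihedralMap (gC * g) = dihedralMap (gD * g) := by
        rw [dihedralMap_mul, dihedralMap_mul, dihedralMap_gC, dihedralMap_gD]
      -- As `c = b * d`, this is the case of `d` up to a left factor `b` in `rightRigid`.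
      rw [h1, ← gB_mul_gD, mul_assoc gB, mul_assoc gB]
      exact mul_mem gB_mem_rightRigid hD
    · exact hD

/-- The generators are the left sections of `b = (a, c)`, `ada = (b, 1)`, `aba = (c, a)` and `aca =
(d, a)`. -/
theorem exists_treeSection_false {g : TreeAut Bool} (hg : g ∈ grigorchukGroup) :
    ∃ h ∈ grigorchukGroup, levelParity 0 h = false ∧ treeSection h [false] = g := by
  induction hg using grigorchuk_induction with
  | one => exact ⟨1, one_mem _, by simp⟩
  | mul s hs g hg ih =>
    obtain ⟨h, hh, h0, rfl⟩ := ih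
    have key : ∀ r ∈ grigorchukGroup, levelParity 0 r = false → treeSection r [false] = s →
        ∃ k ∈ grigorchukGroup, levelParity 0 k = false ∧
          treeSection k [false] = s * treeSection h [false] :=
      fun r hr hr0 hr1 => ⟨r * h, mul_mem hr hh, by
        simp [levelParity_mul, treeSection_mul_bool, hr0, h0, hr1]⟩
    have conj : ∀ r ∈ grigorchukGroup, gA * r * gA ∈ grigorchukGroup :=
      fun r hr => mul_mem (mul_mem gA_mem hr) gA_mem
    rcases hs with rfl | rfl | rfl | rfl
    · exact key gB gB_mem (by simp) (by simp)
    · exact key _ (conj gD gD_mem) (by simp [levelParity_mul])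
        (by simp [treeSection_mul_bool])
    · exact key _ (conj gB gB_mem) (by simp [levelParity_mul])
        (by simp [treeSection_mul_bool])
    · exact key _ (conj gC gC_mem) (by simp [levelParity_mul])
        (by simp [treeSection_mul_bool])

/-- Sufficiency of the swap condition: lift `g₀` to some `k` fixing the first level, then correct
its right section by left multiplication with `l = (1, g₁ * k₁⁻¹)`, where `k₁` is the right section
of `k`. -/
theorem exists_treeSection_eq {g₀ g₁ : TreeAut Bool} (h₀ : g₀ ∈ grigorchukGroup)
    (h₁ : g₁ ∈ grigorchukGroup) (h : dihedralMap g₁ = dihedralSwap (dihedralMap g₀)) (e : Bool) :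
    ∃ g ∈ grigorchukGroup, levelParity 0 g = e ∧ treeSection g [false] = g₀ ∧
      treeSection g [true] = g₁ := by
  obtain ⟨k, hk, hk0, rfl⟩ := exists_treeSection_false h₀
  have h2 := mul_dihedralRep_inv_mem (treeSection_singleton_mem hk true)
  rw [dihedralMap_treeSection hk, ← h] at h2
  have h3 := div_mem (mul_dihedralRep_inv_mem h₁) h2
  rw [mul_div_mul_right_eq_div] at h3
  obtain ⟨l, hl, hl0, hl1, hl2⟩ := h3
  have hlk : levelParity 0 (l * k) = false ∧ treeSection (l * k) [false] = treeSection k [false] ∧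
      treeSection (l * k) [true] = g₁ := by
    simp [levelParity_mul, treeSection_mul_bool, *]
  cases e
  · exact ⟨l * k, mul_mem hl hk, hlk⟩
  -- Left multiplication by `a` flips the root permutation and keeps both sections.
  · exact ⟨gA * (l * k), mul_mem gA_mem (mul_mem hl hk), by
      simp [levelParity_mul 0 gA, treeSection_mul_bool gA, hlk]⟩

/-! ### The nucleus -/

theorem treeSection_nucleusSet {g : TreeAut Bool}
    (hg : g ∈ ({1, gA, gB, gC, gD} : Set (TreeAut Bool))) (u : List Bool) :
    treeSection g u ∈ ({1, gA, gB, gC, gD} : Set (TreeAut Bool)) := by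
  induction u generalizing g with
  | nil => simpa using hg
  | cons x u ih =>
    rw [← List.singleton_append, treeSection_append]
    refine ih ?_
    rcases hg with rfl | hg
    · simp
    · exact treeSection_generator_mem hg x

theorem treeSection_mul_nucleusSet {g h : TreeAut Bool}
    (hg : g ∈ ({1, gA, gB, gC, gD} : Set (TreeAut Bool)))
    (hh : h ∈ ({1, gA, gB, gC, gD} : Set (TreeAut Bool))) (x : Bool) :
    treeSection (g * h) [x] ∈ ({1, gA, gB, gC, gD} : Set (TreeAut Bool)) := by
  rw [treeSection_mul_bool]
  rcases hg with rfl | rfl | rfl | rfl | rfl <;> rcases hh with rfl | rfl | rfl | rfl | rfl <;>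
    cases x <;> simp [gA_mul_self, gB_mul_self, gC_mul_self, gD_mul_self, gB_mul_gC, gC_mul_gD,
      gD_mul_gB, gC_mul_gB, gD_mul_gC, gB_mul_gD]

theorem isAttracting_nucleusSet : IsAttracting grigorchukGroup {1, gA, gB, gC, gD} := by
  refine ⟨Set.toFinite _, fun g hg => nucleusSet_subset hg, fun g hg => ?_⟩
  induction hg using grigorchuk_induction with
  | one => exact ⟨0, fun u _ => by simp⟩
  | mul s hs g hg ih =>
    obtain ⟨n, hn⟩ := ih
    -- Below level `n` the section of the product is a product of two nucleus elements; one more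
    -- level brings it back into the nucleus.
    refine ⟨n + 1, fun u hu => ?_⟩
    obtain ⟨v, x, rfl⟩ : ∃ v x, u = v ++ [x] :=
      ⟨_, _, (List.dropLast_append_getLast (l := u) (by rintro rfl; simp at hu)).symm⟩
    rw [treeSection_append, treeSection_mul]
    exact treeSection_mul_nucleusSet (treeSection_nucleusSet (Set.mem_insert_of_mem _ hs) _)
      (hn v (by simpa using hu)) x

theorem isContracting_grigorchukGroup : IsContracting grigorchukGroup :=
  ⟨isSelfSimilar_grigorchukGroup, _, isAttracting_nucleusSet⟩

/-- Every element of `{b, c, d}` is a section, on any given level, of an element of `{b, c, d}`. -/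
theorem exists_treeSection_eq_of_level (n : ℕ) {g : TreeAut Bool}
    (hg : g ∈ ({gB, gC, gD} : Set (TreeAut Bool))) :
    ∃ h ∈ ({gB, gC, gD} : Set (TreeAut Bool)), ∃ u : List Bool,
      u.length = n ∧ treeSection h u = g := by
  induction n generalizing g with
  | zero => exact ⟨g, hg, [], rfl, treeSection_nil g⟩
  | succ n ih =>
    have step : ∀ k ∈ ({gB, gC, gD} : Set (TreeAut Bool)), treeSection k [true] = g →
        ∃ h ∈ ({gB, gC, gD} : Set (TreeAut Bool)), ∃ u : List Bool,
          u.length = n + 1 ∧ treeSection h u = g := by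
      intro k hk hkg
      obtain ⟨h, hh, u, hu, rfl⟩ := ih hk
      exact ⟨h, hh, u ++ [true], by simp [hu], by rw [treeSection_append, hkg]⟩
    -- Taking right sections permutes the three generators cyclically: `b → c → d → b`.
    rcases hg with rfl | rfl | rfl
    · exact step gD (by simp) (by simp)
    · exact step gB (by simp) (by simp)
    · exact step gC (by simp) (by simp)

theorem nucleus_grigorchukGroup : nucleus grigorchukGroup = {1, gA, gB, gC, gD} := by
  refine Set.Subset.antisymm (Set.sInter_subset_of_mem isAttracting_nucleusSet) ?_
  refine Set.subset_sInter fun M ⟨_, _, hM⟩ => ?_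
  obtain ⟨l, hl⟩ := hM gB gB_mem
  obtain ⟨m, hm⟩ := hM gC gC_mem
  obtain ⟨n, hn⟩ := hM gD gD_mem
  have key : ∀ g ∈ ({gB, gC, gD} : Set (TreeAut Bool)), ∀ v, treeSection g v ∈ M := by
    intro g hg v
    -- The level `l + m + n` is deep enough for whichever of the three generators `h` turns out to
    -- be.
    obtain ⟨h, hh, u, hu, rfl⟩ := exists_treeSection_eq_of_level (l + m + n) hg
    rw [← treeSection_append]
    rcases hh with rfl | rfl | rfl
    · exact hl _ (by rw [List.length_append]; omega)
    · exact hm _ (by rw [List.length_append]; omega)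
    · exact hn _ (by rw [List.length_append]; omega)
  rintro g (rfl | rfl | hg)
  · simpa using key gD (by simp) [false]
  · simpa using key gB (by simp) [false]
  · simpa using key g hg []

/-! ### Elements with portraits of bounded depth -/

/-- The elements of the Grigorchuk group whose portrait has depth at most `n`. -/
def depthSet : ℕ → Set (TreeAut Bool)
  | 0 => {1, gA, gB, gC, gD}
  | n + 1 => {g | g ∈ grigorchukGroup ∧
      treeSection g [false] ∈ depthSet n ∧ treeSection g [true] ∈ depthSet n}

theorem nucleusSet_subset_depthSet (n : ℕ) {g : TreeAut Bool}
    (hg : g ∈ ({1, gA, gB, gC, gD} : Set (TreeAut Bool))) : g ∈ depthSet n := by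
  induction n generalizing g with
  | zero => exact hg
  | succ n ih =>
    exact ⟨nucleusSet_subset hg, ih (treeSection_nucleusSet hg _), ih (treeSection_nucleusSet hg _)⟩

theorem depthSet_subset {n : ℕ} {g : TreeAut Bool} (hg : g ∈ depthSet n) :
    g ∈ grigorchukGroup := by
  cases n with
  | zero => exact nucleusSet_subset hg
  | succ n => exact hg.1

theorem mem_depthSet_iff (n : ℕ) (g : TreeAut Bool) :
    g ∈ depthSet n ↔ g ∈ grigorchukGroup ∧
      ∃ P, IsPortrait {1, gA, gB, gC, gD} g P ∧ P.depth ≤ n := by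
  induction n generalizing g with
  | zero =>
    refine ⟨fun hg => ⟨depthSet_subset hg, _, .leaf hg, le_rfl⟩, ?_⟩
    rintro ⟨-, P, hP, hd⟩
    cases hP with
    | leaf hg => exact hg
    | node hg c hc => simp [Portrait.depth] at hd
  | succ n ih =>
    constructor
    · rintro ⟨hg, h0, h1⟩
      refine ⟨hg, ?_⟩
      by_cases hN : g ∈ ({1, gA, gB, gC, gD} : Set (TreeAut Bool))
      · exact ⟨_, .leaf hN, Nat.zero_le _⟩
      · have hx : ∀ x, ∃ P, IsPortrait {1, gA, gB, gC, gD} (treeSection g [x]) P ∧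
            P.depth ≤ n := fun x => by
          cases x
          exacts [((ih _).1 h0).2, ((ih _).1 h1).2]
        choose c hc hd using hx
        refine ⟨_, .node hN c hc, ?_⟩
        rw [Portrait.depth]
        exact Nat.succ_le_succ (Finset.sup_le fun x _ => hd x)
    · rintro ⟨hg, P, hP, hd⟩
      cases hP with
      | leaf hN => exact nucleusSet_subset_depthSet _ hN
      | node hN c hc =>
        rw [Portrait.depth] at hd
        have hx : ∀ x, treeSection g [x] ∈ depthSet n := fun x =>
          (ih _).2 ⟨treeSection_singleton_mem hg x, c x, hc x,
            (Finset.le_sup (f := fun x => (c x).depth) (Finset.mem_univ x)).trans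
              (Nat.le_of_succ_le_succ hd)⟩
        exact ⟨hg, hx _, hx _⟩

theorem portraitGrowth_eq_ncard (n : ℕ) :
    portraitGrowth grigorchukGroup n = (depthSet n).ncard := by
  rw [portraitGrowth, nucleus_grigorchukGroup]
  congr 1
  ext g
  exact (mem_depthSet_iff n g).symm

theorem treeAut_bool_injective : Function.Injective fun g : TreeAut Bool =>
    (levelParity 0 g, treeSection g [false], treeSection g [true]) := by
  intro g h hgh
  simp only [Prod.mk.injEq] at hgh
  exact treeAut_bool_ext hgh.1 fun x => by cases x; exacts [hgh.2.1, hgh.2.2]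

theorem depthSet_finite (n : ℕ) : (depthSet n).Finite := by
  induction n with
  | zero => exact Set.toFinite {1, gA, gB, gC, gD}
  | succ n ih =>
    exact Set.Finite.of_injOn (t := Set.univ ×ˢ depthSet n ×ˢ depthSet n)
      (fun g hg => ⟨Set.mem_univ _, hg.2.1, hg.2.2⟩) treeAut_bool_injective.injOn
      (Set.finite_univ.prod (ih.prod ih))

/-! ### Counting -/

theorem ncard_eq_sum_ncard_fiber {α β : Type*} [Fintype β] {S : Set α} (hS : S.Finite)
    (f : α → β) : S.ncard = ∑ b, {a ∈ S | f a = b}.ncard := by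
  classical
  rw [Set.ncard_eq_toFinset_card S hS,
    Finset.card_eq_sum_card_fiberwise (f := f) (t := Finset.univ) (fun _ _ => by simp)]
  refine Finset.sum_congr rfl fun b _ => ?_
  rw [← Set.ncard_coe_finset]
  congr 1
  ext a
  simp

/-- The number of elements with portrait of depth at most `n` and given image in the quotient of
order 16. -/
noncomputable def classCount (n : ℕ) (q : Bool) (δ : Bool × Bool × Bool) : ℕ :=
  {g ∈ depthSet n | levelParity 2 g = q ∧ dihedralMap g = δ}.ncard

theorem ncard_depthSet (n : ℕ) :
    (depthSet n).ncard = ∑ c : Bool × Bool × Bool × Bool, classCount n c.1 c.2 := by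
  rw [ncard_eq_sum_ncard_fiber (depthSet_finite n) fun g => (levelParity 2 g, dihedralMap g)]
  refine Finset.sum_congr rfl fun c _ => ?_
  simp only [classCount, Prod.ext_iff]

/-- The parity homomorphism of the dihedral group whose kernel is the rotation subgroup. -/
def dihedralParity (u : Bool × Bool × Bool) : Bool := xor u.1 (xor u.2.1 u.2.2)

/-- The term `dihedralParity` collects `levelParity 3` of the two sections, after the class of the
right one is expressed through that of the left one. -/
theorem levelParity_two_eq {g : TreeAut Bool} (hg : g ∈ grigorchukGroup) :
    levelParity 2 g = xor (xor (levelParity 2 (treeSection g [false]))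
      (levelParity 2 (treeSection g [true])))
      (dihedralParity (dihedralMap (treeSection g [false]))) := by
  have h0 := levelParity_relation (treeSection_singleton_mem hg false)
  have h1 := levelParity_relation (treeSection_singleton_mem hg true)
  have h3 : ∀ k : TreeAut Bool, levelParity 3 k = xor (dihedralMap k).1 (dihedralMap k).2.1 :=
    fun _ => rfl
  have h2 : levelParity 2 g = xor (levelParity 1 (treeSection g [false]))
    (levelParity 1 (treeSection g [true])) := rfl
  rw [h2, h0, h1, h3, h3, dihedralMap_treeSection hg]
  generalize dihedralMap (treeSection g [false]) = u
  generalize levelParity 2 (treeSection g [false]) = s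
  generalize levelParity 2 (treeSection g [true]) = t
  revert u s t
  decide

/-- Sorting by the class `δ` of the left section forces the class `dihedralSwap δ` on the right.
With the root permutation `e` fixed, an element is its pair of sections, so each admissible `δ`
contributes a product. -/
theorem classCount_succ (n : ℕ) (q s t e : Bool) :
    classCount (n + 1) q (s, t, e) = ∑ δ : Bool × Bool × Bool,
      if q = xor (xor s t) (dihedralParity δ) then
        classCount n s δ * classCount n t (dihedralSwap δ) else 0 := by
  rw [classCount, ncard_eq_sum_ncard_fiber ((depthSet_finite _).subset fun _ h => h.1)
    fun g => dihedralMap (treeSection g [false])]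
  refine Finset.sum_congr rfl fun δ _ => ?_
  split_ifs with hq
  · rw [classCount, classCount, ← Set.ncard_prod]
    refine Set.ncard_congr (fun g _ => (treeSection g [false], treeSection g [true])) ?_ ?_ ?_
    · rintro g ⟨⟨⟨hg, h0, h1⟩, -, hd⟩, rfl⟩
      simp only [dihedralMap, Prod.mk.injEq] at hd
      exact ⟨⟨h0, hd.1, rfl⟩, ⟨h1, hd.2.1, dihedralMap_treeSection hg⟩⟩
    · rintro g g' ⟨⟨-, -, hd⟩, -⟩ ⟨⟨-, -, hd'⟩, -⟩ h
      refine treeAut_bool_injective (Prod.ext ?_ h)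
      exact (congrArg (·.2.2) hd).trans (congrArg (·.2.2) hd').symm
    · rintro ⟨g₀, g₁⟩ ⟨⟨h0, h0s, h0d⟩, h1, h1t, h1d⟩
      dsimp only at h0 h0s h0d h1 h1t h1d
      obtain ⟨g, hg, he, rfl, rfl⟩ := exists_treeSection_eq (depthSet_subset h0)
        (depthSet_subset h1) (by rw [h1d, h0d]) e
      refine ⟨g, ⟨⟨⟨hg, h0, h1⟩, ?_, ?_⟩, h0d⟩, rfl⟩
      · rw [levelParity_two_eq hg, h0s, h1t, h0d, hq]
      · rw [dihedralMap, h0s, h1t, he]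
  · rw [Set.ncard_eq_zero ((depthSet_finite (n + 1)).subset fun _ h => h.1.1),
      Set.eq_empty_iff_forall_notMem]
    rintro g ⟨⟨hg, hp, hd⟩, rfl⟩
    simp only [dihedralMap, Prod.mk.injEq] at hd
    have := levelParity_two_eq hg.1
    rw [hp, hd.1, hd.2.1] at this
    exact hq this

/-- The five elements of the nucleus lie in five different classes. -/
theorem classCount_zero (q : Bool) (δ : Bool × Bool × Bool) :
    classCount 0 q δ = if (q, δ) ∈ ({(false, false, false, false), (false, false, false, true),
      (true, false, false, false), (false, false, true, false), (true, false, true, false)} :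
      Finset (Bool × Bool × Bool × Bool)) then 1 else 0 := by
  have h : ∀ r ∈ depthSet 0, ∀ p, levelParity 2 r = p → classCount 0 p (dihedralMap r) = 1 := by
    rintro r hr p rfl
    rw [classCount, Set.ncard_eq_one]
    refine ⟨r, Set.ext fun g => ⟨?_, ?_⟩⟩
    · rintro ⟨hg, h1, h2⟩
      rcases hg with rfl | rfl | rfl | rfl | rfl <;> rcases hr with rfl | rfl | rfl | rfl | rfl <;>
        simp at h1 h2 ⊢
    · rintro rfl
      exact ⟨hr, rfl, rfl⟩
  split_ifs with hc
  · simp only [Finset.mem_insert, Finset.mem_singleton, Prod.mk.injEq] at hc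
    rcases hc with ⟨rfl, rfl⟩ | ⟨rfl, rfl⟩ | ⟨rfl, rfl⟩ | ⟨rfl, rfl⟩ | ⟨rfl, rfl⟩
    · simpa using h 1 (by simp [depthSet])
    · simpa using h gA (by simp [depthSet])
    · simpa using h gB (by simp [depthSet])
    · simpa using h gC (by simp [depthSet])
    · simpa using h gD (by simp [depthSet])
  · rw [classCount, Set.ncard_eq_zero ((depthSet_finite 0).subset fun _ h => h.1),
      Set.eq_empty_iff_forall_notMem]
    rintro g ⟨hg, rfl, rfl⟩
    rcases hg with rfl | rfl | rfl | rfl | rfl <;> simp at hc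

theorem dihedral_sum (f : Bool × Bool × Bool → ℕ) :
    ∑ δ, f δ = f (false, false, false) + f (false, false, true) + f (false, true, false) +
      f (false, true, true) + f (true, false, false) + f (true, false, true) +
      f (true, true, false) + f (true, true, true) := by
  simp only [Fintype.sum_prod_type, Fintype.sum_bool]
  ring

/-- The recursion does not involve `e`. This fails at depth 0, which is why the six sequences start
at 1. -/
theorem classCount_succ_root (n : ℕ) (q s t : Bool) :
    classCount (n + 1) q (s, t, true) = classCount (n + 1) q (s, t, false) := by
  rw [classCount_succ, classCount_succ]

theorem classCount_succ_comm (n : ℕ) (q s t e : Bool) :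
    classCount (n + 1) q (s, t, e) = classCount (n + 1) q (t, s, e) := by
  rw [classCount_succ, classCount_succ]
  refine Fintype.sum_equiv ⟨dihedralSwap, dihedralSwap, dihedralSwap_swap, dihedralSwap_swap⟩ _ _
    fun δ => ?_
  have h : dihedralParity (dihedralSwap δ) = dihedralParity δ := by
    revert δ
    decide
  simp only [Equiv.coe_fn_mk, dihedralSwap_swap, h, Bool.xor_comm s t, mul_comm]

theorem classCount_one : classCount 1 false (false, false, false) = 1 ∧
    classCount 1 false (false, true, false) = 1 ∧ classCount 1 false (true, true, false) = 1 ∧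
    classCount 1 true (false, false, false) = 2 ∧ classCount 1 true (false, true, false) = 1 ∧
    classCount 1 true (true, true, false) = 0 := by
  simp only [classCount_succ, classCount_zero]
  decide

theorem classCount_succ_true_false (n : ℕ) (q e : Bool) :
    classCount (n + 1) q (true, false, e) = classCount (n + 1) q (false, true, e) :=
  classCount_succ_comm n q true false e

end PortraitGrowth

theorem mainTheorem1 :
    PortraitGrowth.IsContracting PortraitGrowth.grigorchukGroup ∧
    PortraitGrowth.nucleus PortraitGrowth.grigorchukGroup =
      {1, PortraitGrowth.gA, PortraitGrowth.gB, PortraitGrowth.gC, PortraitGrowth.gD} ∧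
    ∃ x y z X Y Z : ℕ → ℕ,
      x 1 = 1 ∧ y 1 = 1 ∧ z 1 = 1 ∧ Y 1 = 1 ∧ X 1 = 2 ∧ Z 1 = 0 ∧
      (∀ n : ℕ, 1 ≤ n →
        x (n + 1) = x n ^ 2 + 2 * y n ^ 2 + z n ^ 2 ∧
        y (n + 1) = x n * Y n + Y n * z n + X n * y n + y n * Z n ∧
        z (n + 1) = X n ^ 2 + 2 * Y n ^ 2 + Z n ^ 2 ∧
        X (n + 1) = 2 * x n * y n + 2 * y n * z n ∧
        Y (n + 1) = x n * X n + 2 * y n * Y n + z n * Z n ∧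
        Z (n + 1) = 2 * X n * Y n + 2 * Y n * Z n) ∧
      PortraitGrowth.portraitGrowth PortraitGrowth.grigorchukGroup 0 = 5 ∧
      ∀ n : ℕ, 1 ≤ n →
        PortraitGrowth.portraitGrowth PortraitGrowth.grigorchukGroup n =
          2 * x n + 4 * y n + 2 * z n + 2 * X n + 4 * Y n + 2 * Z n := by
  open PortraitGrowth in
  refine ⟨isContracting_grigorchukGroup, nucleus_grigorchukGroup,
    fun n => classCount n false (false, false, false),
    fun n => classCount n false (false, true, false),
    fun n => classCount n false (true, true, false),
    fun n => classCount n true (false, false, false),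
    fun n => classCount n true (false, true, false),
    fun n => classCount n true (true, true, false), ?_, ?_, ?_, ?_, ?_, ?_, ?_, ?_, ?_⟩
  · exact classCount_one.1
  · exact classCount_one.2.1
  · exact classCount_one.2.2.1
  · exact classCount_one.2.2.2.2.1
  · exact classCount_one.2.2.2.1
  · exact classCount_one.2.2.2.2.2
  · intro n hn
    obtain ⟨n, rfl⟩ := Nat.exists_eq_add_of_le' hn
    beta_reduce
    -- Fixing the argument `n + 1` unfolds a single level; the remaining counts stay at depth at
    -- least 1, where both symmetries apply.
    simp only [classCount_succ (n + 1), dihedral_sum]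
    simp only [dihedralParity, dihedralSwap, dihedralMul, Bool.xor_false, Bool.xor_true,
      Bool.not_false, Bool.not_true, cond_true, cond_false, reduceIte, reduceCtorEq,
      classCount_succ_root, classCount_succ_true_false]
    refine ⟨?_, ?_, ?_, ?_, ?_, ?_⟩ <;> ring
  · rw [portraitGrowth_eq_ncard, ncard_depthSet]
    simp only [classCount_zero]
    decide
  · intro n hn
    obtain ⟨n, rfl⟩ := Nat.exists_eq_add_of_le' hn
    rw [portraitGrowth_eq_ncard, ncard_depthSet]
    simp only [Fintype.sum_prod_type, Fintype.sum_bool, classCount_succ_root,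
      classCount_succ_true_false]
    ring
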